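/- Let $M^*_{2,4}(\mathbb C)$ be the space of $2\times 4$ complex matrices $(A,B)$ (with $A,B$ complex $2\times2$ matrices) of rank $2$, with the topology induced from $\mathbb C^{2\times 4}$, and let $\mathcal A^{\mathbb C}=M^*_{2,4}(\mathbb C)/GL(2,\mathbb C)$, with the quotient topology, where $(A,B)\sim(TA,TB)$ for $T\in GL(2,\mathbb C)$. The class of $(A,B)$ is denoted $[A\,|\,B]$ and called a boundary condition. It is self-adjoint if $AEA^*=BEB^*$, where $E=\begin{pmatrix}0&1\\-1&0\end{pmatrix}$ (this does not depend on the representative). Let $\mathcal B^{\mathbb C}\subset\mathcal A^{\mathbb C}$ be the set of self-adjoint boundary conditions, with the subspace topology. **Theorem 2.2.** The space $\mathcal B^{\mathbb C}$ equals the union of the following subsets, each of which is relatively open in $\mathcal B^{\mathbb C}$: $$\mathcal O_{1,3}^{\mathbb C}=\left\{\begin{bmatrix}1&a_{12}&0&\bar z\\0&z&-1&b_{22}\end{bmatrix}: a_{12},b_{22}\in\mathbb R,\ z\in\mathbb C\right\},\qquad \mathcal O_{1,4}^{\mathbb C}=\left\{\begin{bmatrix}1&a_{12}&\bar z&0\\0&z&b_{21}&1\end{bmatrix}: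 a_{12},b_{21}\in\mathbb R,\ z\in\mathbb C\right\},$$ $$\mathcal O_{2,3}^{\mathbb C}=\left\{\begin{bmatrix}a_{11}&-1&0&\bar z\\z&0&-1&b_{22}\end{bmatrix}: a_{11},b_{22}\in\mathbb R,\ z\in\mathbb C\right\},\qquad \mathcal O_{2,4}^{\mathbb C}=\left\{\begin{bmatrix}a_{11}&-1&\bar z&0\\z&0&b_{21}&1\end{bmatrix}: a_{11},b_{21}\in\mathbb R,\ z\in\mathbb C\right\}.$$ Moreover, $\mathcal B^{\mathbb C}$ is a connected and compact real-analytic manifold of dimension $4$ (Hausdorff and second countable): the maps sending the boundary condition displayed above to $(a_{12},\operatorname{Re}z,\operatorname{Im}z,b_{22})$, $(a_{12},\operatorname{Re}z,\operatorname{Im}z,b_{21})$, $(a_{11},\operatorname{Re}z,\operatorname{Im}z,b_{22})$, $(a_{11},\operatorname{Re}z,\operatorname{Im}z,b_{21})$ on $\mathcal O_{1,3}^{\mathbb C}$, $\mathcal O_{1,4}^{\mathbb C}$, $\mathcal O_{2,3}^{\mathbb C}$, $\mathcal O_{2,4}^{\mathbb C}$, respectively, are well-defined homeomorphisms onto $\mathbb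 R^4$, and these four charts form an atlas with real-analytic transition maps. -/

import Mathlib

open scoped Matrix Manifold ContDiff ComplexConjugate MatrixGroups

namespace SturmLiouville

/-- The `2 × 4` complex matrices `(A, B)` of rank `2`, as a topological subspace of `ℂ^{2×4}`. -/
abbrev CoeffMatrix : Type := {M : Matrix (Fin 2) (Fin 4) ℂ // M.rank = 2}

/-- The block `A` (first two columns) of `(A, B)`. -/
def blockA (M : Matrix (Fin 2) (Fin 4) ℂ) : Matrix (Fin 2) (Fin 2) ℂ := M.submatrix id ![0, 1]

/-- The block `B` (last two columns) of `(A, B)`. -/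
def blockB (M : Matrix (Fin 2) (Fin 4) ℂ) : Matrix (Fin 2) (Fin 2) ℂ := M.submatrix id ![2, 3]

/-- Two coefficient matrices are equivalent if one is `T` times the other, `T ∈ GL(2, ℂ)`. -/
def coeffSetoid : Setoid CoeffMatrix where
  r M M' := ∃ T : GL (Fin 2) ℂ, M'.1 = (T : Matrix (Fin 2) (Fin 2) ℂ) * M.1
  iseqv :=
    { refl := fun M => ⟨1, by simp⟩
      symm := by
        rintro M M' ⟨T, h⟩
        exact ⟨T⁻¹, by rw [h, ← Matrix.mul_assoc, ← Units.val_mul]; simp⟩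
      trans := by
        rintro M M' M'' ⟨T, h⟩ ⟨T', h'⟩
        exact ⟨T' * T, by rw [h', h, ← Matrix.mul_assoc, ← Units.val_mul]⟩ }

/-- The space of boundary conditions: the quotient of the rank-two coefficient matrices by
left multiplication by `GL(2, ℂ)`. -/
def BC : Type := Quotient coeffSetoid

/-- The space of boundary conditions carries the quotient topology. -/
instance : TopologicalSpace BC := inferInstanceAs (TopologicalSpace (Quotient coeffSetoid))

/-- The boundary condition `[A | B]` represented by a coefficient matrix. -/
def BC.mk (M : CoeffMatrix) : BC := Quotient.mk coeffSetoid M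

/-- The matrix `E`. -/
def matE : Matrix (Fin 2) (Fin 2) ℂ := !![0, 1; -1, 0]

/-- The equation `A E A* = B E B*`. -/
def IsSelfAdjointCoeff (M : Matrix (Fin 2) (Fin 4) ℂ) : Prop :=
  blockA M * matE * (blockA M)ᴴ = blockB M * matE * (blockB M)ᴴ

theorem IsSelfAdjointCoeff.mul_left {M : Matrix (Fin 2) (Fin 4) ℂ} (h : IsSelfAdjointCoeff M)
    (T : Matrix (Fin 2) (Fin 2) ℂ) : IsSelfAdjointCoeff (T * M) := by
  have hA : blockA (T * M) = T * blockA M := rfl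
  have hB : blockB (T * M) = T * blockB M := rfl
  have key : T * (blockA M * matE * (blockA M)ᴴ) * Tᴴ
      = T * (blockB M * matE * (blockB M)ᴴ) * Tᴴ := by rw [show _ = _ from h]
  unfold IsSelfAdjointCoeff
  rw [hA, hB, Matrix.conjTranspose_mul, Matrix.conjTranspose_mul]
  simpa only [Matrix.mul_assoc] using key

/-- A boundary condition `[A | B]` is self-adjoint if `A E A* = B E B*`; this does not depend on
the representative. -/
def BC.IsSelfAdjoint : BC → Prop :=
  Quotient.lift (fun M : CoeffMatrix => IsSelfAdjointCoeff M.1) (by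
    intro M M' hMM'
    obtain ⟨T, h⟩ := id hMM'
    obtain ⟨S, h'⟩ := coeffSetoid.symm hMM'
    refine propext ⟨fun hM => ?_, fun hM => ?_⟩
    · rw [h]; exact hM.mul_left _
    · rw [h']; exact hM.mul_left _)

/-- The set of self-adjoint boundary conditions; as a type, it has the subspace topology. -/
def selfAdjointBC : Set BC := {X | X.IsSelfAdjoint}

/-- A `2 × 4` matrix with an invertible `2 × 2` minor has rank two. -/
theorem rank_eq_two {M : Matrix (Fin 2) (Fin 4) ℂ} (c : Fin 2 → Fin 4)
    (h : (M.submatrix id c).det ≠ 0) : M.rank = 2 := by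
  apply le_antisymm
  · simpa using M.rank_le_height
  · calc 2 = (M.submatrix id c).rank := by
          simpa using (Matrix.rank_of_det_ne_zero h).symm
      _ ≤ M.rank := Matrix.rank_submatrix_le M id c

/-- The normalized coefficient matrix `(1, s, 0, z̄; 0, z, -1, t)`. -/
noncomputable def coeff13 (s : ℝ) (z : ℂ) (t : ℝ) : CoeffMatrix :=
  ⟨!![1, (s : ℂ), 0, conj z; 0, z, -1, (t : ℂ)],
    rank_eq_two ![0, 2] (by simp [Matrix.det_fin_two])⟩

/-- The normalized coefficient matrix `(1, s, z̄, 0; 0, z, t, 1)`. -/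
noncomputable def coeff14 (s : ℝ) (z : ℂ) (t : ℝ) : CoeffMatrix :=
  ⟨!![1, (s : ℂ), conj z, 0; 0, z, (t : ℂ), 1],
    rank_eq_two ![0, 3] (by simp [Matrix.det_fin_two])⟩

/-- The normalized coefficient matrix `(s, -1, 0, z̄; z, 0, -1, t)`. -/
noncomputable def coeff23 (s : ℝ) (z : ℂ) (t : ℝ) : CoeffMatrix :=
  ⟨!![(s : ℂ), -1, 0, conj z; z, 0, -1, (t : ℂ)],
    rank_eq_two ![1, 2] (by simp [Matrix.det_fin_two])⟩

/-- The normalized coefficient matrix `(s, -1, z̄, 0; z, 0, t, 1)`. -/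
noncomputable def coeff24 (s : ℝ) (z : ℂ) (t : ℝ) : CoeffMatrix :=
  ⟨!![(s : ℂ), -1, conj z, 0; z, 0, (t : ℂ), 1],
    rank_eq_two ![1, 3] (by simp [Matrix.det_fin_two])⟩

/-- The set `O_{1,3}`. -/
def O13 : Set BC := {X | ∃ (s : ℝ) (z : ℂ) (t : ℝ), X = BC.mk (coeff13 s z t)}

/-- The set `O_{1,4}`. -/
def O14 : Set BC := {X | ∃ (s : ℝ) (z : ℂ) (t : ℝ), X = BC.mk (coeff14 s z t)}

/-- The set `O_{2,3}`. -/
def O23 : Set BC := {X | ∃ (s : ℝ) (z : ℂ) (t : ℝ), X = BC.mk (coeff23 s z t)}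

/-- The set `O_{2,4}`. -/
def O24 : Set BC := {X | ∃ (s : ℝ) (z : ℂ) (t : ℝ), X = BC.mk (coeff24 s z t)}

/-- `O` (a subset of the space of boundary conditions) is relatively open in the space of
self-adjoint boundary conditions. -/
def IsRelOpen (O : Set BC) : Prop :=
  O ⊆ selfAdjointBC ∧ IsOpen ((↑) ⁻¹' O : Set selfAdjointBC)

/-- `φ` is the coordinate chart with domain all of `O` and image all of `ℝ⁴` which maps the boundary
condition with normalized coefficient matrix `coeff s (a + ib) t` to `(s, a, b, t)`. -/
def IsCoordinateChart (O : Set BC) (coeff : ℝ → ℂ → ℝ → CoeffMatrix)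
    (φ : OpenPartialHomeomorph selfAdjointBC (EuclideanSpace ℝ (Fin 4))) : Prop :=
  φ.source = (↑) ⁻¹' O ∧ φ.target = Set.univ ∧
    ∀ (s a b t : ℝ) (X : selfAdjointBC),
      (X : BC) = BC.mk (coeff s ⟨a, b⟩ t) → φ X = !₂[s, a, b, t]

end SturmLiouville

namespace SturmLiouville

/-! The argument runs through Plücker coordinates. Left multiplication by `T` scales all `2 × 2`
minors by `det T`, and proportional minors force equivalence (`BC.mk_eq_mk_iff_minor`). Hence ratios
of minors are functions on `BC`, and the equivalence relation is closed; since the quotient map is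
open, `BC` is Hausdorff.

Determinants in `A E A* = B E B*` give `|p₀₁| = |p₂₃|`, and the Plücker relation `p₀₁ p₂₃ = p₀₂ p₁₃
- p₀₃ p₁₂` then bounds `|p₀₁|` by the mixed minors, those with one column from each block
(`IsSelfAdjointCoeff.norm_minor_le`). So some mixed minor is nonzero. Normalizing its two columns
turns self-adjointness into the reality of two entries and the conjugacy of the other two, which is
one of the four displayed forms. Each chart domain is therefore the nonvanishing set of a mixed
minor, and its coordinates are, up to sign, ratios of minors, so transition maps are rational with
nonvanishing denominators.

The same bound yields compactness, by taking the largest mixed minor as pivot. The four domains are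
images of `ℝ⁴` with a common point, whence connectedness. -/

/-! ### Minors as Plücker coordinates -/

/-- The `2 × 2` minor of `M` formed by the columns `i` and `j`. -/
def minor (M : Matrix (Fin 2) (Fin 4) ℂ) (i j : Fin 4) : ℂ :=
  M 0 i * M 1 j - M 0 j * M 1 i

theorem minor_mul (T : Matrix (Fin 2) (Fin 2) ℂ) (M : Matrix (Fin 2) (Fin 4) ℂ) (i j : Fin 4) :
    minor (T * M) i j = T.det * minor M i j := by
  simp only [minor, Matrix.mul_apply, Fin.sum_univ_two, Matrix.det_fin_two]
  ring

theorem det_submatrix_eq_minor (M : Matrix (Fin 2) (Fin 4) ℂ) (i j : Fin 4) :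
    (M.submatrix id ![i, j]).det = minor M i j := by
  simp [Matrix.det_fin_two, minor]

theorem continuous_minor (i j : Fin 4) : Continuous fun M : CoeffMatrix => minor M.1 i j := by
  unfold minor
  have h : ∀ a k, Continuous fun M : CoeffMatrix => M.1 a k := fun a k =>
    (continuous_apply_apply a k).comp continuous_subtype_val
  exact ((h _ _).mul (h _ _)).sub ((h _ _).mul (h _ _))

theorem minor_plucker (M : Matrix (Fin 2) (Fin 4) ℂ) :
    minor M 0 1 * minor M 2 3 = minor M 0 2 * minor M 1 3 - minor M 0 3 * minor M 1 2 := by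
  unfold minor
  ring

/-- If all minors vanish, each column `i` gives the row relation `M 1 i • row 0 - M 0 i • row 1 =
0`; independence of the rows then kills row `0`, a contradiction. -/
theorem exists_minor_ne_zero (M : CoeffMatrix) : ∃ i j, minor M.1 i j ≠ 0 := by
  by_contra! h
  have hli : LinearIndependent ℂ M.1.row := by
    rw [linearIndependent_iff_card_eq_finrank_span, Set.finrank,
      ← Matrix.rank_eq_finrank_span_row, M.2]
    simp
  have hpair := Fintype.linearIndependent_iff.1 hli
  have hzero : ∀ i, M.1 0 i = 0 := fun i => by
    have := hpair ![M.1 1 i, -M.1 0 i] (by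
      ext j
      have := h i j
      simp only [minor] at this
      simp only [Fin.sum_univ_two, Matrix.row, Pi.add_apply, Pi.smul_apply, smul_eq_mul,
        Matrix.cons_val_zero, Matrix.cons_val_one, Pi.zero_apply]
      linear_combination -this) 1
    simpa using this
  have := hpair ![1, 0] (by ext j; simp [Matrix.row, hzero]) 0
  simp at this

/-- A matrix factors through any of its invertible `2 × 2` blocks, with ratios of minors as
coefficients. -/
theorem submatrix_mul_minor_div (M : Matrix (Fin 2) (Fin 4) ℂ) {i j : Fin 4}
    (h : minor M i j ≠ 0) :
    M.submatrix id ![i, j] * Matrix.of ![fun k => minor M k j / minor M i j,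
      fun k => minor M i k / minor M i j] = M := by
  -- Entrywise this is Cramer's rule.
  ext a k
  simp only [Matrix.mul_apply, Fin.sum_univ_two, Matrix.submatrix_apply, id_eq, Matrix.of_apply,
    Matrix.cons_val_zero, Matrix.cons_val_one]
  field_simp
  fin_cases a <;> simp [minor] <;> ring

theorem BC.mk_eq_mk {M M' : CoeffMatrix} :
    BC.mk M = BC.mk M' ↔ ∃ T : GL (Fin 2) ℂ, M'.1 = (T : Matrix (Fin 2) (Fin 2) ℂ) * M.1 :=
  Quotient.eq (r := coeffSetoid)

/-- Both matrices are their pivot block times the same matrix of ratios, so the quotient of the two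
blocks carries one to the other. -/
theorem BC.mk_eq_mk_of_minor {M M' : CoeffMatrix} {i j : Fin 4} (h : minor M.1 i j ≠ 0)
    (h' : minor M'.1 i j ≠ 0)
    (hr : ∀ k l, minor M.1 k l / minor M.1 i j = minor M'.1 k l / minor M'.1 i j) :
    BC.mk M = BC.mk M' := by
  have hS := submatrix_mul_minor_div M.1 h
  have hS' := submatrix_mul_minor_div M'.1 h'
  simp only [hr] at hS
  rw [BC.mk_eq_mk]
  let S := Matrix.GeneralLinearGroup.mkOfDetNeZero (M.1.submatrix id ![i, j])
    (by rwa [det_submatrix_eq_minor])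
  let S' := Matrix.GeneralLinearGroup.mkOfDetNeZero (M'.1.submatrix id ![i, j])
    (by rwa [det_submatrix_eq_minor])
  refine ⟨S' * S⁻¹, ?_⟩
  conv_rhs => rw [← hS]
  conv_lhs => rw [← hS']
  rw [← Matrix.mul_assoc]
  congr 1
  change S'.val = (S' * S⁻¹).val * S.val
  rw [← Units.val_mul]
  simp

theorem BC.mk_eq_mk_iff_minor {M M' : CoeffMatrix} :
    BC.mk M = BC.mk M' ↔
      ∀ i j k l, minor M.1 i j * minor M'.1 k l = minor M.1 k l * minor M'.1 i j := by
  constructor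
  · rw [BC.mk_eq_mk]
    rintro ⟨T, hT⟩ i j k l
    rw [hT, minor_mul, minor_mul]
    ring
  · intro h
    obtain ⟨i, j, hij⟩ := exists_minor_ne_zero M
    obtain ⟨k, l, hkl⟩ := exists_minor_ne_zero M'
    have hij' : minor M'.1 i j ≠ 0 := fun h0 => by
      have := h i j k l
      simp [h0, hij, hkl] at this
    refine BC.mk_eq_mk_of_minor hij hij' fun a b => ?_
    rw [div_eq_div_iff hij hij', h a b i j]
    ring

/-! ### Topology of the space of boundary conditions -/

theorem isOpenQuotientMap_mk : IsOpenQuotientMap BC.mk := by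
  refine ⟨Quotient.mk_surjective, continuous_quot_mk, fun U hU => ?_⟩
  change IsOpen (BC.mk ⁻¹' (BC.mk '' U))
  have hrank : ∀ (T : GL (Fin 2) ℂ) (M : CoeffMatrix),
      ((T : Matrix (Fin 2) (Fin 2) ℂ) * M.1).rank = 2 := fun T M => by
    rw [Matrix.rank_mul_eq_right_of_isUnit_det _ _
      ((Matrix.isUnit_iff_isUnit_det _).1 T.isUnit), M.2]
  have hcont : ∀ T : GL (Fin 2) ℂ, Continuous fun M : CoeffMatrix =>
      (⟨(T : Matrix (Fin 2) (Fin 2) ℂ) * M.1, hrank T M⟩ : CoeffMatrix) := fun T =>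
    (continuous_const.matrix_mul continuous_subtype_val).subtype_mk _
  -- The saturation of `U` is a union of preimages of `U` under the action of single group elements,
  -- each of which is continuous.
  have : BC.mk ⁻¹' (BC.mk '' U) = ⋃ T : GL (Fin 2) ℂ, (fun M : CoeffMatrix =>
      (⟨(T : Matrix (Fin 2) (Fin 2) ℂ) * M.1, hrank T M⟩ : CoeffMatrix)) ⁻¹' U := by
    ext M
    simp only [Set.mem_preimage, Set.mem_image, Set.mem_iUnion]
    constructor
    · rintro ⟨N, hN, h⟩
      obtain ⟨T, hT⟩ := BC.mk_eq_mk.1 h.symm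
      exact ⟨T, by simpa only [← hT] using hN⟩
    · rintro ⟨T, hT⟩
      exact ⟨_, hT, (BC.mk_eq_mk.2 ⟨T, rfl⟩).symm⟩
  rw [this]
  exact isOpen_iUnion fun T => hU.preimage (hcont T)

instance : T2Space BC := by
  rw [t2Space_iff_of_isOpenQuotientMap isOpenQuotientMap_mk]
  simp only [BC.mk_eq_mk_iff_minor, Set.ofPred_forall]
  refine isClosed_iInter fun i => isClosed_iInter fun j => isClosed_iInter fun k =>
    isClosed_iInter fun l => isClosed_eq ?_ ?_
  · exact ((continuous_minor i j).comp continuous_fst).mul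
      ((continuous_minor k l).comp continuous_snd)
  · exact ((continuous_minor k l).comp continuous_fst).mul
      ((continuous_minor i j).comp continuous_snd)

/-- The ratio of the minors `k, l` and `i, j`, as a function of the boundary condition. -/
noncomputable def BC.ratio (k l i j : Fin 4) : BC → ℂ :=
  Quotient.lift (fun M : CoeffMatrix => minor M.1 k l / minor M.1 i j) (by
    rintro M M' ⟨T, hT⟩
    have : (T : Matrix (Fin 2) (Fin 2) ℂ).det ≠ 0 :=
      ((Matrix.isUnit_iff_isUnit_det _).1 T.isUnit).ne_zero
    simp only [hT, minor_mul]
    rw [mul_div_mul_left _ _ this])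

theorem BC.ratio_mk (k l i j : Fin 4) (M : CoeffMatrix) :
    BC.ratio k l i j (BC.mk M) = minor M.1 k l / minor M.1 i j := rfl

/-- The boundary conditions whose minor `i, j` does not vanish. -/
def BC.pivotSet (i j : Fin 4) : Set BC := {X | BC.ratio i j i j X ≠ 0}

/-- The ratio of a minor to itself is `1`, or `0` by the convention `x / 0 = 0`, so it detects
vanishing. -/
theorem BC.mk_mem_pivotSet {i j : Fin 4} {M : CoeffMatrix} :
    BC.mk M ∈ BC.pivotSet i j ↔ minor M.1 i j ≠ 0 := by
  simp [BC.pivotSet, BC.ratio_mk]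

theorem BC.isOpen_pivotSet (i j : Fin 4) : IsOpen (BC.pivotSet i j) := by
  rw [← isOpenQuotientMap_mk.isQuotientMap.isOpen_preimage]
  have : BC.mk ⁻¹' BC.pivotSet i j = {M | minor M.1 i j ≠ 0} := by
    ext M
    exact BC.mk_mem_pivotSet
  rw [this]
  exact isOpen_ne_fun (continuous_minor i j) continuous_const

theorem BC.continuousOn_ratio (k l i j : Fin 4) :
    ContinuousOn (BC.ratio k l i j) (BC.pivotSet i j) := by
  rw [isOpenQuotientMap_mk.isQuotientMap.continuousOn_isOpen_iff (BC.isOpen_pivotSet i j)]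
  exact (continuous_minor k l).continuousOn.div (continuous_minor i j).continuousOn
    fun M hM => BC.mk_mem_pivotSet.1 hM

/-! ### Self-adjointness and the mixed minors -/

theorem IsSelfAdjointCoeff.norm_minor_eq {M : Matrix (Fin 2) (Fin 4) ℂ}
    (h : IsSelfAdjointCoeff M) : ‖minor M 0 1‖ = ‖minor M 2 3‖ := by
  have hdet := congrArg (fun N => ‖Matrix.det N‖) (show _ = _ from h)
  have hA : (blockA M).det = minor M 0 1 := det_submatrix_eq_minor M 0 1
  have hB : (blockB M).det = minor M 2 3 := det_submatrix_eq_minor M 2 3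
  simp only [Matrix.det_mul, Matrix.det_conjTranspose, hA, hB, norm_mul, norm_star] at hdet
  have hE : ‖matE.det‖ = 1 := by simp [matE, Matrix.det_fin_two]
  rw [hE, mul_one, mul_one] at hdet
  exact (mul_self_inj (norm_nonneg _) (norm_nonneg _)).1 hdet

/-- The minors formed by one column of `A` and one column of `B`. -/
def mixedMinor (M : Matrix (Fin 2) (Fin 4) ℂ) (i j : Fin 2) : ℂ :=
  minor M (![0, 1] i) (![2, 3] j)

/-- Used with `r = 0` for the covering and with `r` the largest mixed minor for compactness. The
argument gives the factor `√2`, relaxed to `2`. -/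
theorem IsSelfAdjointCoeff.norm_minor_le {M : Matrix (Fin 2) (Fin 4) ℂ}
    (h : IsSelfAdjointCoeff M) {r : ℝ} (hr : ∀ i j, ‖mixedMinor M i j‖ ≤ r) :
    ‖minor M 0 1‖ ≤ 2 * r := by
  have h02 : ‖minor M 0 2‖ ≤ r := hr 0 0
  have h03 : ‖minor M 0 3‖ ≤ r := hr 0 1
  have h12 : ‖minor M 1 2‖ ≤ r := hr 1 0
  have h13 : ‖minor M 1 3‖ ≤ r := hr 1 1
  have hr0 : 0 ≤ r := (norm_nonneg _).trans h02
  have h1 : ‖minor M 0 1‖ * ‖minor M 0 1‖ ≤ r * r + r * r := by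
    nth_rewrite 2 [h.norm_minor_eq]
    rw [← norm_mul, minor_plucker]
    refine (norm_sub_le _ _).trans ?_
    rw [norm_mul, norm_mul]
    gcongr
  nlinarith [norm_nonneg (minor M 0 1)]

theorem exists_mixedMinor_ne_zero (M : CoeffMatrix) (h : IsSelfAdjointCoeff M.1) :
    ∃ i j, mixedMinor M.1 i j ≠ 0 := by
  by_contra! h0
  have h01 : minor M.1 0 1 = 0 := by
    simpa using h.norm_minor_le (r := 0) (by simp [h0])
  have h23 : minor M.1 2 3 = 0 := by
    rw [← norm_eq_zero, ← h.norm_minor_eq, h01, norm_zero]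
  have h02 : minor M.1 0 2 = 0 := h0 0 0
  have h03 : minor M.1 0 3 = 0 := h0 0 1
  have h12 : minor M.1 1 2 = 0 := h0 1 0
  have h13 : minor M.1 1 3 = 0 := h0 1 1
  obtain ⟨i, j, hij⟩ := exists_minor_ne_zero M
  have hanti : ∀ i j, minor M.1 j i = 0 → minor M.1 i j = 0 := fun i j h => by
    rw [← neg_eq_zero, ← h]; unfold minor; ring
  have hself : ∀ i, minor M.1 i i = 0 := fun i => by unfold minor; ring
  apply hij
  fin_cases i <;> fin_cases j <;>
    first | exact hself _ | assumption | exact hanti _ _ (by assumption)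

theorem isSelfAdjointCoeff_iff {M : Matrix (Fin 2) (Fin 4) ℂ} :
    IsSelfAdjointCoeff M ↔ ∀ a b, M a 0 * conj (M b 1) - M a 1 * conj (M b 0) =
      M a 2 * conj (M b 3) - M a 3 * conj (M b 2) := by
  unfold IsSelfAdjointCoeff
  rw [← Matrix.ext_iff]
  refine forall₂_congr fun a b => ?_
  simp only [blockA, blockB, matE, Matrix.mul_apply, Fin.sum_univ_two, Matrix.submatrix_apply,
    Matrix.conjTranspose_apply, id_eq, Matrix.of_apply, Matrix.cons_val_zero, Matrix.cons_val_one,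
    RCLike.star_def, Matrix.cons_val', Matrix.cons_val_fin_one]
  constructor <;> intro h <;> linear_combination h

/-- Left multiplication by `D` times the inverse of the pivot block replaces that block by `D`. -/
theorem BC.exists_mk_eq_of_pivot {M : CoeffMatrix} (hM : IsSelfAdjointCoeff M.1) {i j : Fin 4}
    (h : minor M.1 i j ≠ 0) {D : Matrix (Fin 2) (Fin 2) ℂ} (hD : D.det ≠ 0) :
    ∃ N : CoeffMatrix, BC.mk M = BC.mk N ∧ IsSelfAdjointCoeff N.1 ∧
      N.1.submatrix id ![i, j] = D := by
  let S := Matrix.GeneralLinearGroup.mkOfDetNeZero (M.1.submatrix id ![i, j])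
    (by rwa [det_submatrix_eq_minor])
  let T := Matrix.GeneralLinearGroup.mkOfDetNeZero D hD * S⁻¹
  have hT : (T.val * M.1).submatrix id ![i, j] = D := by
    have : (T.val * M.1).submatrix id ![i, j] = T.val * S.val := rfl
    rw [this, ← Units.val_mul]
    simp [T, Matrix.GeneralLinearGroup.mkOfDetNeZero]
  exact ⟨⟨T.val * M.1, rank_eq_two ![i, j] (by rwa [hT])⟩, BC.mk_eq_mk.2 ⟨T, rfl⟩,
    hM.mul_left _, hT⟩

/-! ### The four normal forms -/

/-- A normal form of self-adjoint boundary conditions, with pivots in column `i` of `A` and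
column `j` of `B`. -/
structure NormalForm (i j : Fin 2) where
  coeff : ℝ → ℂ → ℝ → CoeffMatrix
  (sgnS sgnZ sgnT : ℝ)
  abs_sgnS : |sgnS| = 1
  abs_sgnZ : |sgnZ| = 1
  abs_sgnT : |sgnT| = 1
  contDiff_coeff : ∀ a k, ContDiff ℝ ω fun v : EuclideanSpace ℝ (Fin 4) =>
    (coeff (v 0) ⟨v 1, v 2⟩ (v 3)).1 a k
  isSelfAdjoint : ∀ s z t, IsSelfAdjointCoeff (coeff s z t).1
  pivot_ne_zero : ∀ s z t, mixedMinor (coeff s z t).1 i j ≠ 0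
  s_eq : ∀ s z t,
    sgnS * (mixedMinor (coeff s z t).1 i.rev j / mixedMinor (coeff s z t).1 i j).re = s
  z_eq : ∀ s z t, sgnZ * (minor (coeff s z t).1 0 1 / mixedMinor (coeff s z t).1 i j) = z
  t_eq : ∀ s z t,
    sgnT * (mixedMinor (coeff s z t).1 i j.rev / mixedMinor (coeff s z t).1 i j).re = t
  exists_mk_eq : ∀ M : CoeffMatrix, IsSelfAdjointCoeff M.1 → mixedMinor M.1 i j ≠ 0 →
    ∃ s z t, BC.mk M = BC.mk (coeff s z t)

theorem contDiff_ofReal_apply (i : Fin 4) :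
    ContDiff ℝ ω fun v : EuclideanSpace ℝ (Fin 4) => ((v i : ℝ) : ℂ) :=
  Complex.ofRealCLM.contDiff.comp (contDiff_euclidean.1 contDiff_id i)

theorem contDiff_complex_mk (i j : Fin 4) :
    ContDiff ℝ ω fun v : EuclideanSpace ℝ (Fin 4) => (⟨v i, v j⟩ : ℂ) := by
  simp only [Complex.mk_eq_add_mul_I]
  exact (contDiff_ofReal_apply i).add ((contDiff_ofReal_apply j).mul contDiff_const)

theorem contDiff_conj_mk (i j : Fin 4) :
    ContDiff ℝ ω fun v : EuclideanSpace ℝ (Fin 4) => conj (⟨v i, v j⟩ : ℂ) :=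
  Complex.conjCLE.contDiff.comp (contDiff_complex_mk i j)

/-- The normal form of the boundary conditions in `O13`. -/
noncomputable def normalForm13 : NormalForm 0 0 where
  coeff := coeff13
  sgnS := 1
  sgnZ := -1
  sgnT := -1
  abs_sgnS := by simp
  abs_sgnZ := by simp
  abs_sgnT := by simp
  contDiff_coeff a k := by
    fin_cases a <;> fin_cases k <;> simp [coeff13] <;>
      first
      | exact contDiff_const
      | exact contDiff_ofReal_apply _
      | exact contDiff_complex_mk _ _
      | exact contDiff_conj_mk _ _
  isSelfAdjoint s z t := by
    rw [isSelfAdjointCoeff_iff]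
    simp [coeff13, Fin.forall_fin_two]
  pivot_ne_zero s z t := by simp [coeff13, mixedMinor, minor]
  s_eq s z t := by simp [coeff13, mixedMinor, minor, div_neg]
  z_eq s z t := by simp [coeff13, mixedMinor, minor, div_neg]
  t_eq s z t := by simp [coeff13, mixedMinor, minor, div_neg]
  exists_mk_eq M hM h := by
    obtain ⟨N, hMN, hN, hD⟩ := BC.exists_mk_eq_of_pivot hM h (D := !![1, 0; 0, -1]) (by simp)
    obtain ⟨h00, h01, h10, h11⟩ : N.1 0 0 = 1 ∧ N.1 0 2 = 0 ∧
        N.1 1 0 = 0 ∧ N.1 1 2 = -1 := by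
      simpa [← Matrix.ext_iff, Fin.forall_fin_two, and_assoc] using hD
    rw [isSelfAdjointCoeff_iff] at hN
    -- Both sides of the self-adjointness equation are skew-Hermitian, so entry `(1, 0)` is
    -- redundant. The diagonal entries make `s` and `t` real; the off-diagonal one ties the
    -- remaining two entries by conjugation.
    have e00 := hN 0 0
    have e01 := hN 0 1
    have e11 := hN 1 1
    simp only [h00, h01, h10, h11, map_zero, map_one, map_neg] at e00 e01 e11
    have hs : ((N.1 0 1).re : ℂ) = N.1 0 1 :=
      Complex.conj_eq_iff_re.1 (by linear_combination e00)
    have ht : ((N.1 1 3).re : ℂ) = N.1 1 3 :=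
      Complex.conj_eq_iff_re.1 (by linear_combination e11)
    have hz : conj (N.1 1 1) = N.1 0 3 := by linear_combination e01
    refine ⟨(N.1 0 1).re, N.1 1 1, (N.1 1 3).re, hMN.trans (congrArg _ (Subtype.ext ?_))⟩
    ext a k
    fin_cases a <;> fin_cases k <;> simp [coeff13, h00, h01, h10, h11, hs, ht, hz]

/-- The normal form of the boundary conditions in `O14`. -/
noncomputable def normalForm14 : NormalForm 0 1 where
  coeff := coeff14
  sgnS := 1
  sgnZ := 1
  sgnT := 1
  abs_sgnS := by simp
  abs_sgnZ := by simp
  abs_sgnT := by simp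
  contDiff_coeff a k := by
    fin_cases a <;> fin_cases k <;> simp [coeff14] <;>
      first
      | exact contDiff_const
      | exact contDiff_ofReal_apply _
      | exact contDiff_complex_mk _ _
      | exact contDiff_conj_mk _ _
  isSelfAdjoint s z t := by
    rw [isSelfAdjointCoeff_iff]
    simp [coeff14, Fin.forall_fin_two]
  pivot_ne_zero s z t := by simp [coeff14, mixedMinor, minor]
  s_eq s z t := by simp [coeff14, mixedMinor, minor]
  z_eq s z t := by simp [coeff14, mixedMinor, minor]
  t_eq s z t := by simp [coeff14, mixedMinor, minor]
  exists_mk_eq M hM h := by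
    obtain ⟨N, hMN, hN, hD⟩ := BC.exists_mk_eq_of_pivot hM h (D := !![1, 0; 0, 1]) (by simp)
    obtain ⟨h00, h01, h10, h11⟩ : N.1 0 0 = 1 ∧ N.1 0 3 = 0 ∧
        N.1 1 0 = 0 ∧ N.1 1 3 = 1 := by
      simpa [← Matrix.ext_iff, Fin.forall_fin_two, and_assoc] using hD
    rw [isSelfAdjointCoeff_iff] at hN
    have e00 := hN 0 0
    have e01 := hN 0 1
    have e11 := hN 1 1
    simp only [h00, h01, h10, h11, map_zero, map_one] at e00 e01 e11
    have hs : ((N.1 0 1).re : ℂ) = N.1 0 1 :=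
      Complex.conj_eq_iff_re.1 (by linear_combination e00)
    have ht : ((N.1 1 2).re : ℂ) = N.1 1 2 :=
      Complex.conj_eq_iff_re.1 (by linear_combination e11)
    have hz : conj (N.1 1 1) = N.1 0 2 := by linear_combination e01
    refine ⟨(N.1 0 1).re, N.1 1 1, (N.1 1 2).re, hMN.trans (congrArg _ (Subtype.ext ?_))⟩
    ext a k
    fin_cases a <;> fin_cases k <;> simp [coeff14, h00, h01, h10, h11, hs, ht, hz]

/-- The normal form of the boundary conditions in `O23`. -/
noncomputable def normalForm23 : NormalForm 1 0 where
  coeff := coeff23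
  sgnS := -1
  sgnZ := 1
  sgnT := -1
  abs_sgnS := by simp
  abs_sgnZ := by simp
  abs_sgnT := by simp
  contDiff_coeff a k := by
    fin_cases a <;> fin_cases k <;> simp [coeff23] <;>
      first
      | exact contDiff_const
      | exact contDiff_ofReal_apply _
      | exact contDiff_complex_mk _ _
      | exact contDiff_conj_mk _ _
  isSelfAdjoint s z t := by
    rw [isSelfAdjointCoeff_iff]
    simp [coeff23, Fin.forall_fin_two]
  pivot_ne_zero s z t := by simp [coeff23, mixedMinor, minor]
  s_eq s z t := by simp [coeff23, mixedMinor, minor]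
  z_eq s z t := by simp [coeff23, mixedMinor, minor]
  t_eq s z t := by simp [coeff23, mixedMinor, minor]
  exists_mk_eq M hM h := by
    obtain ⟨N, hMN, hN, hD⟩ := BC.exists_mk_eq_of_pivot hM h (D := !![-1, 0; 0, -1]) (by simp)
    obtain ⟨h00, h01, h10, h11⟩ : N.1 0 1 = -1 ∧ N.1 0 2 = 0 ∧
        N.1 1 1 = 0 ∧ N.1 1 2 = -1 := by
      simpa [← Matrix.ext_iff, Fin.forall_fin_two, and_assoc] using hD
    rw [isSelfAdjointCoeff_iff] at hN
    have e00 := hN 0 0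
    have e01 := hN 0 1
    have e11 := hN 1 1
    simp only [h00, h01, h10, h11, map_zero, map_one, map_neg] at e00 e01 e11
    have hs : ((N.1 0 0).re : ℂ) = N.1 0 0 :=
      Complex.conj_eq_iff_re.1 (by linear_combination e00)
    have ht : ((N.1 1 3).re : ℂ) = N.1 1 3 :=
      Complex.conj_eq_iff_re.1 (by linear_combination e11)
    have hz : conj (N.1 1 0) = N.1 0 3 := by linear_combination e01
    refine ⟨(N.1 0 0).re, N.1 1 0, (N.1 1 3).re, hMN.trans (congrArg _ (Subtype.ext ?_))⟩
    ext a k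
    fin_cases a <;> fin_cases k <;> simp [coeff23, h00, h01, h10, h11, hs, ht, hz]

/-- The normal form of the boundary conditions in `O24`. -/
noncomputable def normalForm24 : NormalForm 1 1 where
  coeff := coeff24
  sgnS := -1
  sgnZ := -1
  sgnT := 1
  abs_sgnS := by simp
  abs_sgnZ := by simp
  abs_sgnT := by simp
  contDiff_coeff a k := by
    fin_cases a <;> fin_cases k <;> simp [coeff24] <;>
      first
      | exact contDiff_const
      | exact contDiff_ofReal_apply _
      | exact contDiff_complex_mk _ _
      | exact contDiff_conj_mk _ _
  isSelfAdjoint s z t := by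
    rw [isSelfAdjointCoeff_iff]
    simp [coeff24, Fin.forall_fin_two]
  pivot_ne_zero s z t := by simp [coeff24, mixedMinor, minor]
  s_eq s z t := by simp [coeff24, mixedMinor, minor, div_neg]
  z_eq s z t := by simp [coeff24, mixedMinor, minor, div_neg]
  t_eq s z t := by simp [coeff24, mixedMinor, minor, div_neg]
  exists_mk_eq M hM h := by
    obtain ⟨N, hMN, hN, hD⟩ := BC.exists_mk_eq_of_pivot hM h (D := !![-1, 0; 0, 1]) (by simp)
    obtain ⟨h00, h01, h10, h11⟩ : N.1 0 1 = -1 ∧ N.1 0 3 = 0 ∧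
        N.1 1 1 = 0 ∧ N.1 1 3 = 1 := by
      simpa [← Matrix.ext_iff, Fin.forall_fin_two, and_assoc] using hD
    rw [isSelfAdjointCoeff_iff] at hN
    have e00 := hN 0 0
    have e01 := hN 0 1
    have e11 := hN 1 1
    simp only [h00, h01, h10, h11, map_zero, map_one, map_neg] at e00 e01 e11
    have hs : ((N.1 0 0).re : ℂ) = N.1 0 0 :=
      Complex.conj_eq_iff_re.1 (by linear_combination e00)
    have ht : ((N.1 1 2).re : ℂ) = N.1 1 2 :=
      Complex.conj_eq_iff_re.1 (by linear_combination e11)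
    have hz : conj (N.1 1 0) = N.1 0 2 := by linear_combination e01
    refine ⟨(N.1 0 0).re, N.1 1 0, (N.1 1 2).re, hMN.trans (congrArg _ (Subtype.ext ?_))⟩
    ext a k
    fin_cases a <;> fin_cases k <;> simp [coeff24, h00, h01, h10, h11, hs, ht, hz]

/-! ### Charts defined by a normal form -/

namespace NormalForm

variable {i j : Fin 2} (N : NormalForm i j)

/-- The set of boundary conditions that have the given normal form. -/
def carrier : Set BC := {X | ∃ (s : ℝ) (z : ℂ) (t : ℝ), X = BC.mk (N.coeff s z t)}

/-- The boundary condition with given coordinates. -/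
def param (v : EuclideanSpace ℝ (Fin 4)) : selfAdjointBC :=
  ⟨BC.mk (N.coeff (v 0) ⟨v 1, v 2⟩ (v 3)), N.isSelfAdjoint _ _ _⟩

theorem continuous_param : Continuous N.param := by
  refine (continuous_quot_mk.comp (Continuous.subtype_mk ?_ _)).subtype_mk _
  exact continuous_matrix fun a k => (N.contDiff_coeff a k).continuous

/-- The coordinates of a boundary condition, as ratios of minors. -/
noncomputable def coord (X : BC) : EuclideanSpace ℝ (Fin 4) :=
  !₂[N.sgnS * (BC.ratio (![0, 1] i.rev) (![2, 3] j) (![0, 1] i) (![2, 3] j) X).re,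
    N.sgnZ * (BC.ratio 0 1 (![0, 1] i) (![2, 3] j) X).re,
    N.sgnZ * (BC.ratio 0 1 (![0, 1] i) (![2, 3] j) X).im,
    N.sgnT * (BC.ratio (![0, 1] i) (![2, 3] j.rev) (![0, 1] i) (![2, 3] j) X).re]

theorem coord_mk_coeff (s : ℝ) (z : ℂ) (t : ℝ) :
    N.coord (BC.mk (N.coeff s z t)) = !₂[s, z.re, z.im, t] := by
  have hs := N.s_eq s z t
  have ht := N.t_eq s z t
  have hre := congrArg Complex.re (N.z_eq s z t)
  have him := congrArg Complex.im (N.z_eq s z t)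
  rw [Complex.re_ofReal_mul] at hre
  rw [Complex.im_ofReal_mul] at him
  simp only [mixedMinor] at hs ht hre him
  simp only [coord, BC.ratio_mk, hs, ht, hre, him]

theorem coord_param (v : EuclideanSpace ℝ (Fin 4)) : N.coord (N.param v) = v := by
  ext k
  simp only [param, coord_mk_coeff]
  fin_cases k <;> rfl

theorem param_mem_carrier (v : EuclideanSpace ℝ (Fin 4)) : (N.param v : BC) ∈ N.carrier :=
  ⟨_, _, _, rfl⟩

theorem param_coord {X : selfAdjointBC} (hX : (X : BC) ∈ N.carrier) :
    N.param (N.coord X) = X := by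
  obtain ⟨s, z, t, h⟩ := hX
  ext
  rw [h, coord_mk_coeff]
  rfl

theorem carrier_subset : N.carrier ⊆ selfAdjointBC := by
  rintro _ ⟨s, z, t, rfl⟩
  exact N.isSelfAdjoint s z t

theorem carrier_subset_pivotSet : N.carrier ⊆ BC.pivotSet (![0, 1] i) (![2, 3] j) := by
  rintro _ ⟨s, z, t, rfl⟩
  exact BC.mk_mem_pivotSet.2 (N.pivot_ne_zero s z t)

/-- Turns membership in a chart domain into an open condition, and lets the covering be checked on
minors. -/
theorem mk_mem_carrier {M : CoeffMatrix} (h : IsSelfAdjointCoeff M.1) :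
    BC.mk M ∈ N.carrier ↔ mixedMinor M.1 i j ≠ 0 :=
  ⟨fun hM => BC.mk_mem_pivotSet.1 (N.carrier_subset_pivotSet hM), N.exists_mk_eq M h⟩

theorem preimage_carrier : ((↑) ⁻¹' N.carrier : Set selfAdjointBC) =
    (↑) ⁻¹' BC.pivotSet (![0, 1] i) (![2, 3] j) := by
  ext ⟨X, hX⟩
  obtain ⟨M, rfl⟩ := Quotient.mk_surjective X
  exact (N.mk_mem_carrier hX).trans BC.mk_mem_pivotSet.symm

theorem isOpen_preimage_carrier : IsOpen ((↑) ⁻¹' N.carrier : Set selfAdjointBC) := by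
  rw [preimage_carrier]
  exact (BC.isOpen_pivotSet _ _).preimage continuous_subtype_val

theorem isRelOpen_carrier : IsRelOpen N.carrier := ⟨N.carrier_subset, N.isOpen_preimage_carrier⟩

theorem continuousOn_coord :
    ContinuousOn N.coord (BC.pivotSet (![0, 1] i) (![2, 3] j)) := by
  have hre : ∀ (c : ℝ) (k l : Fin 4), ContinuousOn
      (fun X => c * (BC.ratio k l (![0, 1] i) (![2, 3] j) X).re)
      (BC.pivotSet (![0, 1] i) (![2, 3] j)) := fun c k l =>
    continuousOn_const.mul (Complex.continuous_re.comp_continuousOn (BC.continuousOn_ratio _ _ _ _))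
  have him : ∀ (c : ℝ) (k l : Fin 4), ContinuousOn
      (fun X => c * (BC.ratio k l (![0, 1] i) (![2, 3] j) X).im)
      (BC.pivotSet (![0, 1] i) (![2, 3] j)) := fun c k l =>
    continuousOn_const.mul (Complex.continuous_im.comp_continuousOn (BC.continuousOn_ratio _ _ _ _))
  refine (PiLp.continuous_toLp 2 _).comp_continuousOn (continuousOn_pi.2 fun m => ?_)
  fin_cases m
  · exact hre _ _ _
  · exact hre _ _ _
  · exact him _ _ _
  · exact hre _ _ _

/-- The coordinate chart defined by a normal form. -/
noncomputable def chart : OpenPartialHomeomorph selfAdjointBC (EuclideanSpace ℝ (Fin 4)) where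
  toFun X := N.coord X
  invFun := N.param
  source := Subtype.val ⁻¹' N.carrier
  target := Set.univ
  map_source' _ _ := Set.mem_univ _
  map_target' v _ := N.param_mem_carrier v
  left_inv' _ hX := N.param_coord hX
  right_inv' v _ := N.coord_param v
  open_source := N.isOpen_preimage_carrier
  open_target := isOpen_univ
  continuousOn_toFun := N.continuousOn_coord.comp continuous_subtype_val.continuousOn
    fun _ hX => N.carrier_subset_pivotSet hX
  continuousOn_invFun := N.continuous_param.continuousOn

theorem isCoordinateChart : IsCoordinateChart N.carrier N.coeff N.chart :=
  ⟨rfl, rfl, fun s a b t X hX => by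
    change N.coord X = _
    rw [hX, coord_mk_coeff]⟩

/-- The minors of a normal form are analytic in its parameters, and the denominator, the pivot minor
of `N'`, does not vanish on the overlap. -/
theorem contDiffOn_coord_param {i' j' : Fin 2} (N' : NormalForm i' j') :
    ContDiffOn ℝ ω (fun v => N'.coord (N.param v)) {v | (N.param v : BC) ∈ N'.carrier} := by
  have hminor : ∀ k l, ContDiff ℝ ω fun v : EuclideanSpace ℝ (Fin 4) =>
      minor (N.coeff (v 0) ⟨v 1, v 2⟩ (v 3)).1 k l := fun k l =>
    ((N.contDiff_coeff _ _).mul (N.contDiff_coeff _ _)).sub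
      ((N.contDiff_coeff _ _).mul (N.contDiff_coeff _ _))
  have hratio : ∀ k l, ContDiffOn ℝ ω
      (fun v => BC.ratio k l (![0, 1] i') (![2, 3] j') (N.param v))
      {v | (N.param v : BC) ∈ N'.carrier} := fun k l => by
    simp only [param, BC.ratio_mk, div_eq_mul_inv]
    exact (hminor k l).contDiffOn.mul ((hminor _ _).contDiffOn.inv fun v hv =>
      BC.mk_mem_pivotSet.1 (N'.carrier_subset_pivotSet hv))
  rw [contDiffOn_euclidean]
  intro m
  fin_cases m
  · exact contDiffOn_const.mul (Complex.reCLM.contDiff.comp_contDiffOn (hratio _ _))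
  · exact contDiffOn_const.mul (Complex.reCLM.contDiff.comp_contDiffOn (hratio _ _))
  · exact contDiffOn_const.mul (Complex.imCLM.contDiff.comp_contDiffOn (hratio _ _))
  · exact contDiffOn_const.mul (Complex.reCLM.contDiff.comp_contDiffOn (hratio _ _))

/-- With a pivot of maximal modulus every coordinate is at most `2` in absolute value, so the norm
is at most `√(4 · 2²) = 4`. -/
theorem norm_coord_le {M : CoeffMatrix} (h : IsSelfAdjointCoeff M.1)
    (hmax : ∀ k l, ‖mixedMinor M.1 k l‖ ≤ ‖mixedMinor M.1 i j‖) :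
    ‖N.coord (BC.mk M)‖ ≤ 4 := by
  have h01 := h.norm_minor_le hmax
  have hs : |N.coord (BC.mk M) 0| ≤ 2 := by
    change |N.sgnS * (mixedMinor M.1 i.rev j / mixedMinor M.1 i j).re| ≤ 2
    rw [abs_mul, N.abs_sgnS, one_mul]
    refine (Complex.abs_re_le_norm _).trans ?_
    rw [norm_div]
    refine div_le_of_le_mul₀ (norm_nonneg _) zero_le_two ?_
    linarith [hmax i.rev j, norm_nonneg (mixedMinor M.1 i j)]
  have ht : |N.coord (BC.mk M) 3| ≤ 2 := by
    change |N.sgnT * (mixedMinor M.1 i j.rev / mixedMinor M.1 i j).re| ≤ 2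
    rw [abs_mul, N.abs_sgnT, one_mul]
    refine (Complex.abs_re_le_norm _).trans ?_
    rw [norm_div]
    refine div_le_of_le_mul₀ (norm_nonneg _) zero_le_two ?_
    linarith [hmax i j.rev, norm_nonneg (mixedMinor M.1 i j)]
  have hz : ‖minor M.1 0 1 / mixedMinor M.1 i j‖ ≤ 2 := by
    rw [norm_div]
    exact div_le_of_le_mul₀ (norm_nonneg _) zero_le_two h01
  have hre : |N.coord (BC.mk M) 1| ≤ 2 := by
    change |N.sgnZ * (minor M.1 0 1 / mixedMinor M.1 i j).re| ≤ 2
    rw [abs_mul, N.abs_sgnZ, one_mul]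
    exact (Complex.abs_re_le_norm _).trans hz
  have him : |N.coord (BC.mk M) 2| ≤ 2 := by
    change |N.sgnZ * (minor M.1 0 1 / mixedMinor M.1 i j).im| ≤ 2
    rw [abs_mul, N.abs_sgnZ, one_mul]
    exact (Complex.abs_im_le_norm _).trans hz
  rw [EuclideanSpace.norm_eq, Real.sqrt_le_left (by norm_num)]
  simp only [Fin.sum_univ_four, Real.norm_eq_abs]
  nlinarith [abs_nonneg (N.coord (BC.mk M) 0), abs_nonneg (N.coord (BC.mk M) 1),
    abs_nonneg (N.coord (BC.mk M) 2), abs_nonneg (N.coord (BC.mk M) 3)]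

theorem isPreconnected_preimage_carrier :
    IsPreconnected ((↑) ⁻¹' N.carrier : Set selfAdjointBC) := by
  have : ((↑) ⁻¹' N.carrier : Set selfAdjointBC) = Set.range N.param := by
    ext X
    exact ⟨fun hX => ⟨_, N.param_coord hX⟩, by rintro ⟨v, rfl⟩; exact N.param_mem_carrier v⟩
  rw [this]
  exact isPreconnected_range N.continuous_param

end NormalForm

/-! ### Covering, compactness and connectedness -/

/-- The four normal forms. -/
noncomputable def normalForm : ∀ i j : Fin 2, NormalForm i j
  | 0, 0 => normalForm13
  | 0, 1 => normalForm14
  | 1, 0 => normalForm23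
  | 1, 1 => normalForm24

theorem exists_mem_carrier (X : selfAdjointBC) : ∃ i j, (X : BC) ∈ (normalForm i j).carrier := by
  obtain ⟨X, hX⟩ := X
  obtain ⟨M, rfl⟩ := Quotient.mk_surjective X
  obtain ⟨i, j, h⟩ := exists_mixedMinor_ne_zero M hX
  exact ⟨i, j, ((normalForm i j).mk_mem_carrier hX).2 h⟩

theorem selfAdjointBC_eq_union : selfAdjointBC = O13 ∪ O14 ∪ O23 ∪ O24 := by
  refine Set.Subset.antisymm (fun X hX => ?_) ?_
  · obtain ⟨i, j, h⟩ := exists_mem_carrier ⟨X, hX⟩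
    fin_cases i <;> fin_cases j
    · exact Or.inl (Or.inl (Or.inl h))
    · exact Or.inl (Or.inl (Or.inr h))
    · exact Or.inl (Or.inr h)
    · exact Or.inr h
  · exact Set.union_subset (Set.union_subset (Set.union_subset normalForm13.carrier_subset
      normalForm14.carrier_subset) normalForm23.carrier_subset) normalForm24.carrier_subset

/-- Choosing the largest mixed minor as pivot places each point in the image of a closed ball of
radius `4` under one of four continuous parametrizations. -/
instance : CompactSpace selfAdjointBC := by
  refine ⟨?_⟩
  have : (Set.univ : Set selfAdjointBC) = ⋃ p : Fin 2 × Fin 2,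
      (normalForm p.1 p.2).param '' Metric.closedBall 0 4 := by
    refine (Set.eq_univ_of_forall fun ⟨X, hX⟩ => ?_).symm
    obtain ⟨M, rfl⟩ := Quotient.mk_surjective X
    obtain ⟨p, hp⟩ := Finite.exists_max fun p : Fin 2 × Fin 2 => ‖mixedMinor M.1 p.1 p.2‖
    have hmax : ∀ k l, ‖mixedMinor M.1 k l‖ ≤ ‖mixedMinor M.1 p.1 p.2‖ := fun k l => hp (k, l)
    have hne : mixedMinor M.1 p.1 p.2 ≠ 0 := by
      obtain ⟨k, l, hkl⟩ := exists_mixedMinor_ne_zero M hX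
      exact norm_pos_iff.1 ((norm_pos_iff.2 hkl).trans_le (hmax k l))
    refine Set.mem_iUnion.2 ⟨p, (normalForm p.1 p.2).coord (BC.mk M), ?_,
      (normalForm p.1 p.2).param_coord (X := ⟨BC.mk M, hX⟩)
        (((normalForm p.1 p.2).mk_mem_carrier hX).2 hne)⟩
    simpa using (normalForm p.1 p.2).norm_coord_le hX hmax
  rw [this]
  exact isCompact_iUnion fun p =>
    (isCompact_closedBall _ _).image (normalForm p.1 p.2).continuous_param

instance : ConnectedSpace selfAdjointBC := by
  -- The matrix `(1, 1, 0, 0; 0, 0, -1, 1)` has all four mixed minors equal to `±1`, so it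
  -- represents a point common to all chart domains.
  have hcoeff := normalForm13.isSelfAdjoint 1 0 1
  have : (Set.univ : Set selfAdjointBC) = ⋃ p : Fin 2 × Fin 2,
      (↑) ⁻¹' (normalForm p.1 p.2).carrier := by
    refine (Set.eq_univ_of_forall fun X => ?_).symm
    obtain ⟨i, j, h⟩ := exists_mem_carrier X
    exact Set.mem_iUnion.2 ⟨(i, j), h⟩
  refine connectedSpace_iff_univ.2 ⟨⟨⟨BC.mk (coeff13 1 0 1), hcoeff⟩, trivial⟩, ?_⟩
  rw [this]
  refine isPreconnected_iUnion ⟨⟨BC.mk (coeff13 1 0 1), hcoeff⟩, Set.mem_iInter.2 fun p => ?_⟩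
    fun p => (normalForm p.1 p.2).isPreconnected_preimage_carrier
  refine ((normalForm p.1 p.2).mk_mem_carrier hcoeff).2 ?_
  obtain ⟨i, j⟩ := p
  fin_cases i <;> fin_cases j <;> simp [mixedMinor, minor, coeff13, normalForm13]

/-! ### The analytic atlas -/

/-- The charted space structure given by the four coordinate charts. -/
noncomputable abbrev chartedSpace : ChartedSpace (EuclideanSpace ℝ (Fin 4)) selfAdjointBC where
  atlas := Set.range fun p : Fin 2 × Fin 2 => (normalForm p.1 p.2).chart
  chartAt X := (normalForm (exists_mem_carrier X).choose
    (exists_mem_carrier X).choose_spec.choose).chart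
  mem_chart_source X := (exists_mem_carrier X).choose_spec.choose_spec
  chart_mem_atlas _ := ⟨(_, _), rfl⟩

theorem chartedSpace_atlas : chartedSpace.atlas =
    {normalForm13.chart, normalForm14.chart, normalForm23.chart, normalForm24.chart} := by
  ext φ
  change φ ∈ Set.range _ ↔ _
  simp only [Set.mem_range, Prod.exists, Fin.exists_fin_two, Set.mem_insert_iff,
    Set.mem_singleton_iff, normalForm, or_assoc, eq_comm]

theorem isManifold_chartedSpace :
    @IsManifold ℝ _ (EuclideanSpace ℝ (Fin 4)) _ _ (EuclideanSpace ℝ (Fin 4)) _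
      𝓘(ℝ, EuclideanSpace ℝ (Fin 4)) ω selfAdjointBC _ chartedSpace := by
  let := chartedSpace
  refine isManifold_of_contDiffOn _ _ _ ?_
  rintro _ _ ⟨p, rfl⟩ ⟨q, rfl⟩
  refine ((normalForm p.1 p.2).contDiffOn_coord_param (normalForm q.1 q.2)).mono ?_
  rintro v ⟨⟨-, hv⟩, -⟩
  exact hv

end SturmLiouville

theorem theorem2p2 :
    SturmLiouville.selfAdjointBC =
      SturmLiouville.O13 ∪ SturmLiouville.O14 ∪ SturmLiouville.O23 ∪ SturmLiouville.O24 ∧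
    SturmLiouville.IsRelOpen SturmLiouville.O13 ∧
    SturmLiouville.IsRelOpen SturmLiouville.O14 ∧
    SturmLiouville.IsRelOpen SturmLiouville.O23 ∧
    SturmLiouville.IsRelOpen SturmLiouville.O24 ∧
    ConnectedSpace SturmLiouville.selfAdjointBC ∧
    CompactSpace SturmLiouville.selfAdjointBC ∧
    T2Space SturmLiouville.selfAdjointBC ∧
    SecondCountableTopology SturmLiouville.selfAdjointBC ∧
    ∃ φ13 φ14 φ23 φ24 :
        OpenPartialHomeomorph SturmLiouville.selfAdjointBC (EuclideanSpace ℝ (Fin 4)),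
      SturmLiouville.IsCoordinateChart SturmLiouville.O13 SturmLiouville.coeff13 φ13 ∧
      SturmLiouville.IsCoordinateChart SturmLiouville.O14 SturmLiouville.coeff14 φ14 ∧
      SturmLiouville.IsCoordinateChart SturmLiouville.O23 SturmLiouville.coeff23 φ23 ∧
      SturmLiouville.IsCoordinateChart SturmLiouville.O24 SturmLiouville.coeff24 φ24 ∧
      ∃ cs : ChartedSpace (EuclideanSpace ℝ (Fin 4)) SturmLiouville.selfAdjointBC,
        cs.atlas = {φ13, φ14, φ23, φ24} ∧
        IsManifold 𝓘(ℝ, EuclideanSpace ℝ (Fin 4)) ω SturmLiouville.selfAdjointBC := by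
  open SturmLiouville in
  exact ⟨selfAdjointBC_eq_union, normalForm13.isRelOpen_carrier, normalForm14.isRelOpen_carrier,
    normalForm23.isRelOpen_carrier, normalForm24.isRelOpen_carrier, inferInstance, inferInstance,
    -- The Hausdorff property is inherited from `BC`; second countability follows from compactness
    -- and the charts into `ℝ⁴`.
    inferInstance, @ChartedSpace.secondCountable_of_sigmaCompact (EuclideanSpace ℝ (Fin 4)) _ _ _
      chartedSpace _ _,
    normalForm13.chart, normalForm14.chart, normalForm23.chart, normalForm24.chart,
    normalForm13.isCoordinateChart, normalForm14.isCoordinateChart,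
    normalForm23.isCoordinateChart, normalForm24.isCoordinateChart,
    chartedSpace, chartedSpace_atlas, isManifold_chartedSpace⟩
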